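/- A Euclidean Jordan algebra is a finite-dimensional real inner product space $\mathbb X$ with a bilinear commutative product $\circ$ that has a unit element and satisfies $x\circ(x^2\circ y)=x^2\circ(x\circ y)$ (where $x^2=x\circ x$) and $\langle x\circ y,z\rangle=\langle y,x\circ z\rangle$ for all $x,y,z\in\mathbb X$. Its symmetric cone is $K_{\mathbb X}=\{x\circ x:x\in\mathbb X\}$. An element $c\in\mathbb X$ is idempotent if $c\circ c=c$; an idempotent is primitive if it is nonzero and is not the sum of two nonzero idempotents. Let $\mathbb X$ be a Euclidean Jordan algebra, $\mathbb V$ a finite-dimensional real inner product space, $G:\mathbb X\to\mathbb V$ a linear map, and let $P=G(K_{\mathbb X})$ be a LISC cone (linear image of a symmetric cone), that is, $P$ is a closed convex cone such that - $G(c)\neq 0$ for every primitive idempotent $c\in\mathbb X$, and - $P$ is pointed, i.e. $P\cap(-P)=\{0\}$. Then $Gx\neq 0$ for every $x\in K_{\mathbb X}\setminus\{0\}$. -/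

import Mathlib

open scoped Pointwise

/-- A Euclidean Jordan algebra structure on a finite-dimensional real inner product space `X`:
a bilinear, commutative product with unit satisfying the Jordan identity
`x ∘ (x² ∘ y) = x² ∘ (x ∘ y)`, for which the inner product is associative. -/
structure EuclideanJordanAlgebra (X : Type*) [NormedAddCommGroup X] [InnerProductSpace ℝ X]
    [FiniteDimensional ℝ X] where
  /-- The Jordan product `x ∘ y`. -/
  mul : X →ₗ[ℝ] X →ₗ[ℝ] X
  /-- The unit element `e`. -/
  unit : X
  mul_comm : ∀ x y : X, mul x y = mul y x
  unit_mul : ∀ x : X, mul unit x = x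
  jordan : ∀ x y : X, mul x (mul (mul x x) y) = mul (mul x x) (mul x y)
  inner_mul : ∀ x y z : X, inner ℝ (mul x y) z = inner ℝ y (mul x z)

namespace EuclideanJordanAlgebra

variable {X : Type*} [NormedAddCommGroup X] [InnerProductSpace ℝ X] [FiniteDimensional ℝ X]

/-- `c` is idempotent: `c ∘ c = c`. -/
def IsIdempotent (A : EuclideanJordanAlgebra X) (c : X) : Prop :=
  A.mul c c = c

/-- `c` is a primitive idempotent: a nonzero idempotent that is not the sum of two nonzero
idempotents. -/
def IsPrimitiveIdempotent (A : EuclideanJordanAlgebra X) (c : X) : Prop :=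
  A.IsIdempotent c ∧ c ≠ 0 ∧
    ¬ ∃ a b : X, A.IsIdempotent a ∧ a ≠ 0 ∧ A.IsIdempotent b ∧ b ≠ 0 ∧ c = a + b

/-- The symmetric cone `K_X = {x ∘ x : x ∈ X}` of squares. -/
def symmetricCone (A : EuclideanJordanAlgebra X) : Set X :=
  {x : X | ∃ y : X, x = A.mul y y}

end EuclideanJordanAlgebra

/-- The closed convex cone `P` is a LISC cone (linear image of a symmetric cone), represented as
`P = G(K_X)`. Here `ProperCone ℝ V` is Mathlib's type of nonempty closed convex cones in `V`. -/
structure IsLISCCone {X V : Type*} [NormedAddCommGroup X] [InnerProductSpace ℝ X]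
    [FiniteDimensional ℝ X] [NormedAddCommGroup V] [InnerProductSpace ℝ V]
    (A : EuclideanJordanAlgebra X) (G : X →ₗ[ℝ] V) (P : ProperCone ℝ V) : Prop where
  image_eq : G '' A.symmetricCone = (P : Set V)
  map_primitive_ne_zero : ∀ c : X, A.IsPrimitiveIdempotent c → G c ≠ 0
  pointed : (P : Set V) ∩ -(P : Set V) = {0}

/-! If `G` kills some `y ∘ y ≠ 0`, it kills a primitive idempotent. There are a nonzero idempotent
`c₀` and `μ ≠ 0` with `y ∘ c₀ = μ c₀` (`exists_isIdempotent_mul_eq_smul`), so `(y - μ c₀)² = y² - μ²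
c₀`. Applying `G` puts `-G c₀` in `P` along with `G c₀`, and pointedness gives `G c₀ = 0`. A nonzero
idempotent of least norm in `ker G` is then primitive: if it is `a + b`, pointedness also gives `G a
= 0`, while `a` is strictly shorter. No full spectral theorem is needed, only power associativity in
the form `mul_self_aeval`. -/

namespace EuclideanJordanAlgebra

variable {X : Type*} [NormedAddCommGroup X] [InnerProductSpace ℝ X] [FiniteDimensional ℝ X]

/-- The full linearization of the Jordan identity. -/
theorem jordan_linearized (A : EuclideanJordanAlgebra X) (a b c d : X) :
    A.mul a (A.mul (A.mul b c) d) + A.mul b (A.mul (A.mul c a) d) +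
        A.mul c (A.mul (A.mul a b) d) =
      A.mul (A.mul b c) (A.mul a d) + A.mul (A.mul c a) (A.mul b d) +
        A.mul (A.mul a b) (A.mul c d) := by
  have h := A.jordan (a + b + c) d
  have hab := A.jordan (a + b) d
  have hbc := A.jordan (b + c) d
  have hac := A.jordan (a + c) d
  have ha := A.jordan a d
  have hb := A.jordan b d
  have hc := A.jordan c d
  simp only [map_add, LinearMap.add_apply, A.mul_comm b a, A.mul_comm c b, A.mul_comm c a]
    at h hab hbc hac ha hb hc ⊢
  linear_combination (norm := module) (1 / 2 : ℝ) • (h - hab - hbc - hac + ha + hb + hc)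

/-- Two instances of the linearized identity share the same right side; subtracting them isolates
this operator. With `u` a power of `x` it becomes a two-step recursion for multiplication by powers.
-/
theorem mul_mul_mul_eq (A : EuclideanJordanAlgebra X) (x u : X) :
    A.mul (A.mul x (A.mul x u)) =
      A.mul x * A.mul (A.mul x u) + A.mul x * A.mul (A.mul x u) + A.mul u * A.mul (A.mul x x) -
        A.mul x * A.mul x * A.mul u - A.mul u * (A.mul x * A.mul x) := by
  ext d
  have h₁ := A.jordan_linearized x x u d
  have h₂ := A.jordan_linearized d x u x
  simp only [LinearMap.add_apply, LinearMap.sub_apply, Module.End.mul_apply]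
  simp only [A.mul_comm u x, A.mul_comm d x, A.mul_comm u d, A.mul_comm (A.mul d u) x,
    A.mul_comm (A.mul x d) x, A.mul_comm (A.mul x u) x, A.mul_comm (A.mul x u) (A.mul x d),
    A.mul_comm (A.mul d u) (A.mul x x), A.mul_comm d (A.mul x (A.mul x u))] at h₁ h₂ ⊢
  linear_combination (norm := module) h₂ - h₁

theorem commute_mul_mul_self (A : EuclideanJordanAlgebra X) (x : X) :
    Commute (A.mul x) (A.mul (A.mul x x)) :=
  LinearMap.ext fun y => A.jordan x y

/-- Multiplication by a power of `x` commutes with multiplication by `x` and by `x²`. -/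
theorem commute_mul_pow (A : EuclideanJordanAlgebra X) (x : X) (n : ℕ) :
    Commute (A.mul ((A.mul x ^ n) A.unit)) (A.mul x) ∧
      Commute (A.mul ((A.mul x ^ n) A.unit)) (A.mul (A.mul x x)) := by
  induction n using Nat.twoStepInduction with
  | zero =>
    have h : A.mul ((A.mul x ^ 0) A.unit) = 1 := LinearMap.ext fun y => A.unit_mul y
    rw [h]
    exact ⟨Commute.one_left _, Commute.one_left _⟩
  | one =>
    have h : (A.mul x ^ 1) A.unit = x := by rw [pow_one, A.mul_comm, A.unit_mul]
    rw [h]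
    exact ⟨Commute.refl _, A.commute_mul_mul_self x⟩
  | more n ih₀ ih₁ =>
    have h : (A.mul x ^ (n + 2)) A.unit = A.mul x (A.mul x ((A.mul x ^ n) A.unit)) := by
      rw [pow_succ', pow_succ']; rfl
    have h' : (A.mul x ^ (n + 1)) A.unit = A.mul x ((A.mul x ^ n) A.unit) := by
      rw [pow_succ']; rfl
    rw [h'] at ih₁
    rw [h, mul_mul_mul_eq]
    have key (S : Module.End ℝ X) (hx : Commute (A.mul x) S)
        (hxx : Commute (A.mul (A.mul x x)) S)
        (h₀ : Commute (A.mul ((A.mul x ^ n) A.unit)) S)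
        (h₁ : Commute (A.mul (A.mul x ((A.mul x ^ n) A.unit))) S) := by
      exact (((((hx.mul_left h₁).add_left (hx.mul_left h₁)).add_left (h₀.mul_left hxx)).sub_left
        ((hx.mul_left hx).mul_left h₀)).sub_left (h₀.mul_left (hx.mul_left hx)))
    exact ⟨key _ (Commute.refl _) (A.commute_mul_mul_self x).symm ih₀.1 ih₁.1,
      key _ (A.commute_mul_mul_self x) (Commute.refl _) ih₀.2 ih₁.2⟩

theorem commute_mul_aeval (A : EuclideanJordanAlgebra X) (x : X) (q : Polynomial ℝ) :
    Commute (A.mul (Polynomial.aeval (A.mul x) q A.unit)) (A.mul x) := by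
  induction q using Polynomial.induction_on' with
  | add p q hp hq =>
    rw [map_add, LinearMap.add_apply, map_add]
    exact hp.add_left hq
  | monomial n r =>
    rw [Polynomial.aeval_monomial, ← Algebra.smul_def, LinearMap.smul_apply, map_smul]
    exact (A.commute_mul_pow x n).1.smul_left r

/-- Multiplication by `w = q(L_x) e` commutes with `q(L_x)`; evaluate both products at the unit `e`.
-/
theorem mul_self_aeval (A : EuclideanJordanAlgebra X) (x : X) (q : Polynomial ℝ) :
    A.mul (Polynomial.aeval (A.mul x) q A.unit) (Polynomial.aeval (A.mul x) q A.unit) =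
      Polynomial.aeval (A.mul x) q (Polynomial.aeval (A.mul x) q A.unit) := by
  set w := Polynomial.aeval (A.mul x) q A.unit with hw
  have h : Commute (A.mul w) (Polynomial.aeval (A.mul x) q) := by
    rw [Polynomial.aeval_eq_sum_range]
    exact Commute.sum_right _ _ _ fun i _ =>
      ((A.commute_mul_aeval x q).pow_right i).smul_right _
  have h' := LinearMap.congr_fun h.eq A.unit
  rw [Module.End.mul_apply, Module.End.mul_apply, ← hw, A.mul_comm w A.unit, A.unit_mul] at h'
  exact h'

theorem isSymmetric_mul (A : EuclideanJordanAlgebra X) (x : X) : (A.mul x).IsSymmetric :=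
  fun y z => A.inner_mul x y z

theorem mul_self_ne_zero (A : EuclideanJordanAlgebra X) {x : X} (hx : x ≠ 0) :
    A.mul x x ≠ 0 := by
  intro h
  have h' := A.inner_mul x x A.unit
  rw [h, A.mul_comm x A.unit, A.unit_mul, inner_zero_left] at h'
  exact hx (inner_self_eq_zero.mp h'.symm)

/-- The span of the powers of `x`, including the unit. -/
noncomputable def powers (A : EuclideanJordanAlgebra X) (x : X) : Submodule ℝ X :=
  LinearMap.range ((LinearMap.applyₗ A.unit).comp (Polynomial.aeval (A.mul x)).toLinearMap)

theorem mem_powers {A : EuclideanJordanAlgebra X} {x w : X} :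
    w ∈ A.powers x ↔ ∃ q : Polynomial ℝ, Polynomial.aeval (A.mul x) q A.unit = w :=
  Iff.rfl

theorem mul_mem_powers (A : EuclideanJordanAlgebra X) (x : X) :
    ∀ w ∈ A.powers x, A.mul x w ∈ A.powers x := by
  rintro _ ⟨q, rfl⟩
  refine mem_powers.mpr ⟨Polynomial.X * q, ?_⟩
  rw [map_mul, Polynomial.aeval_X]
  rfl

/-- A nonzero element acts with a nonzero eigenvalue on some nonzero idempotent. -/
theorem exists_isIdempotent_mul_eq_smul (A : EuclideanJordanAlgebra X) {x : X} (hx : x ≠ 0) :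
    ∃ (c : X) (μ : ℝ), A.IsIdempotent c ∧ c ≠ 0 ∧ μ ≠ 0 ∧ A.mul x c = μ • c := by
  -- On the powers of `x` every eigenvector `w` is `q(L_x) e` for some `q`, so `w ∘ w = q(L_x) w =
  -- q(μ) w`, and rescaling makes `w` idempotent.
  have hS : ((A.mul x).restrict (A.mul_mem_powers x)).IsSymmetric :=
    (A.isSymmetric_mul x).restrict_invariant (A.mul_mem_powers x)
  have hunit : A.unit ∈ A.powers x := mem_powers.mpr ⟨1, by rw [map_one]; rfl⟩
  obtain ⟨i, hi⟩ : ∃ i, hS.eigenvalues rfl i ≠ 0 := by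
    by_contra! h
    have h0 : (A.mul x).restrict (A.mul_mem_powers x) = 0 := by
      refine (hS.eigenvectorBasis rfl).toBasis.ext fun i => ?_
      rw [OrthonormalBasis.coe_toBasis, hS.apply_eigenvectorBasis, h i]
      simp
    have h1 := congrArg Subtype.val (LinearMap.congr_fun h0 ⟨A.unit, hunit⟩)
    exact hx (by rw [← A.unit_mul x, A.mul_comm]; exact h1)
  set μ : ℝ := hS.eigenvalues rfl i with hμ
  obtain ⟨w, hw⟩ : ∃ w, w = hS.eigenvectorBasis rfl i := ⟨_, rfl⟩
  have hw0 : (w : X) ≠ 0 := by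
    rw [hw, Ne, Submodule.coe_eq_zero]
    exact (hS.eigenvectorBasis rfl).orthonormal.ne_zero i
  have hxw : A.mul x w = μ • (w : X) := by
    have h := congrArg Subtype.val (hS.apply_eigenvectorBasis rfl i)
    rw [← hw] at h
    exact h
  obtain ⟨q, hq⟩ := mem_powers.mp w.2
  have hww : A.mul w w = q.eval μ • (w : X) := by
    have h := A.mul_self_aeval x q
    rw [hq] at h
    rw [h]
    exact Module.End.aeval_apply_of_hasEigenvector
      ⟨Module.End.mem_eigenspace_iff.mpr hxw, hw0⟩
  have hqμ : q.eval μ ≠ 0 := by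
    intro h
    rw [h, zero_smul] at hww
    exact A.mul_self_ne_zero hw0 hww
  refine ⟨(q.eval μ)⁻¹ • (w : X), μ, ?_, smul_ne_zero (inv_ne_zero hqμ) hw0, hi, ?_⟩
  · rw [IsIdempotent, map_smul, map_smul, LinearMap.smul_apply, hww, inv_smul_smul₀ hqμ]
  · rw [map_smul, hxw, smul_comm]

theorem IsIdempotent.mem_symmetricCone {A : EuclideanJordanAlgebra X} {c : X}
    (hc : A.IsIdempotent c) : c ∈ A.symmetricCone :=
  ⟨c, hc.symm⟩

/-- The right side is linear in `c`, so squared norms add when idempotents sum to an idempotent. -/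
theorem IsIdempotent.norm_sq {A : EuclideanJordanAlgebra X} {c : X} (hc : A.IsIdempotent c) :
    ‖c‖ ^ 2 = inner ℝ c A.unit := by
  have h := A.inner_mul c c A.unit
  rw [hc, A.mul_comm c A.unit, A.unit_mul, real_inner_self_eq_norm_sq] at h
  exact h.symm

/-- The Jordan product as a continuous bilinear map. -/
noncomputable def mulCLM (A : EuclideanJordanAlgebra X) : X →L[ℝ] X →L[ℝ] X :=
  LinearMap.toContinuousLinearMap (LinearMap.toContinuousLinearMap.toLinearMap.comp A.mul)

theorem continuous_mul_self (A : EuclideanJordanAlgebra X) :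
    Continuous fun x : X => A.mul x x := by
  exact A.mulCLM.continuous.clm_apply continuous_id

/-- Nonzero idempotents are bounded away from zero. -/
theorem exists_pos_le_norm_of_isIdempotent (A : EuclideanJordanAlgebra X) :
    ∃ δ : ℝ, 0 < δ ∧ ∀ c : X, A.IsIdempotent c → c ≠ 0 → δ ≤ ‖c‖ := by
  -- The `+ 1` keeps the constant positive even if the product is zero.
  refine ⟨(‖A.mulCLM‖ + 1)⁻¹, by positivity, fun c hc hc0 => ?_⟩
  have h : ‖c‖ ≤ ‖A.mulCLM‖ * ‖c‖ * ‖c‖ := by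
    have h := A.mulCLM.le_opNorm₂ c c
    have hB : A.mulCLM c c = c := hc
    rwa [hB] at h
  have hpos : 0 < ‖c‖ := norm_pos_iff.mpr hc0
  rw [inv_le_iff_one_le_mul₀ (by positivity)]
  nlinarith

/-- A nonempty closed family of nonzero idempotents has a member of least norm. -/
theorem exists_isIdempotent_norm_le (A : EuclideanJordanAlgebra X) {F : Set X} (hF : IsClosed F)
    (hne : ∃ c ∈ F, A.IsIdempotent c ∧ c ≠ 0) :
    ∃ c ∈ F, A.IsIdempotent c ∧ c ≠ 0 ∧
      ∀ d ∈ F, A.IsIdempotent d → d ≠ 0 → ‖c‖ ≤ ‖d‖ := by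
  obtain ⟨δ, hδ, hle⟩ := A.exists_pos_le_norm_of_isIdempotent
  -- The bound `δ ≤ ‖c‖` replaces the open condition `c ≠ 0` by a closed one, which makes `S`
  -- compact.
  let S : Set X := F ∩ ({c | A.mul c c = c} ∩ {c | δ ≤ ‖c‖})
  have hclosed : IsClosed S :=
    hF.inter ((isClosed_eq A.continuous_mul_self continuous_id).inter
      (isClosed_le continuous_const continuous_norm))
  have hsub : S ⊆ Metric.closedBall 0 ‖A.unit‖ := by
    rintro c ⟨-, hc, hcδ⟩
    rw [mem_closedBall_zero_iff]
    have h₁ := IsIdempotent.norm_sq (A := A) hc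
    have h₂ := real_inner_le_norm c A.unit
    have hpos : 0 < ‖c‖ := hδ.trans_le hcδ
    nlinarith
  have hcomp : IsCompact S := (isCompact_closedBall 0 ‖A.unit‖).of_isClosed_subset hclosed hsub
  obtain ⟨c₀, hc₀F, hc₀, hc₀'⟩ := hne
  obtain ⟨c, hcS, hmin⟩ := hcomp.exists_isMinOn ⟨c₀, hc₀F, hc₀, hle c₀ hc₀ hc₀'⟩
    continuous_norm.continuousOn
  exact ⟨c, hcS.1, hcS.2.1, norm_pos_iff.mp (hδ.trans_le hcS.2.2),
    fun d hdF hd hd0 => hmin ⟨hdF, hd, hle d hd hd0⟩⟩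

theorem norm_lt_norm_add (A : EuclideanJordanAlgebra X) {a b : X} (ha : A.IsIdempotent a)
    (hb : A.IsIdempotent b) (hab : A.IsIdempotent (a + b)) (hb0 : b ≠ 0) : ‖a‖ < ‖a + b‖ := by
  have h := hab.norm_sq
  rw [inner_add_left, ← ha.norm_sq, ← hb.norm_sq] at h
  have hpos : 0 < ‖b‖ := norm_pos_iff.mpr hb0
  exact lt_of_pow_lt_pow_left₀ 2 (norm_nonneg _) (by rw [h]; nlinarith)

end EuclideanJordanAlgebra

theorem lemma3p1 {X V : Type*}
    [NormedAddCommGroup X] [InnerProductSpace ℝ X] [FiniteDimensional ℝ X]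
    [NormedAddCommGroup V] [InnerProductSpace ℝ V] [FiniteDimensional ℝ V]
    (A : EuclideanJordanAlgebra X) (G : X →ₗ[ℝ] V) (P : ProperCone ℝ V)
    (hP : IsLISCCone A G P) :
    ∀ x ∈ A.symmetricCone, x ≠ 0 → G x ≠ 0 := by
  rintro _ ⟨y, rfl⟩ hx hGx
  have hmem : ∀ z ∈ A.symmetricCone, G z ∈ (P : Set V) := fun z hz =>
    hP.image_eq ▸ Set.mem_image_of_mem G hz
  have hzero : ∀ v ∈ (P : Set V), -v ∈ (P : Set V) → v = 0 := fun v hv hv' => by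
    have h : v ∈ (P : Set V) ∩ -(P : Set V) := ⟨hv, hv'⟩
    rwa [hP.pointed] at h
  have hy : y ≠ 0 := by
    rintro rfl
    simp at hx
  obtain ⟨c₀, μ, hc₀, hc₀0, hμ, hyc⟩ := A.exists_isIdempotent_mul_eq_smul hy
  have hGc₀ : G c₀ = 0 := by
    refine hzero _ (hmem _ hc₀.mem_symmetricCone) ?_
    have hsq : A.mul (y - μ • c₀) (y - μ • c₀) = A.mul y y - (μ * μ) • c₀ := by
      have hcc : A.mul c₀ c₀ = c₀ := hc₀
      simp only [map_sub, LinearMap.sub_apply, map_smul, LinearMap.smul_apply,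
        A.mul_comm c₀ y, hyc, hcc]
      module
    -- This element squares to `μ⁻² y² - c₀`, which `G` sends to `-G c₀`.
    have hz := hmem _ ⟨μ⁻¹ • (y - μ • c₀), rfl⟩
    rw [map_smul, map_smul, map_smul, LinearMap.smul_apply, hsq, map_smul, map_sub, hGx,
      zero_sub, map_smul, smul_neg, smul_neg, smul_smul, smul_smul] at hz
    have hone : μ⁻¹ * μ⁻¹ * (μ * μ) = 1 := by field_simp
    rwa [hone, one_smul] at hz
  obtain ⟨c, hGc, hc, hc0, hmin⟩ := A.exists_isIdempotent_norm_le
    (Submodule.closed_of_finiteDimensional (LinearMap.ker G)) ⟨c₀, hGc₀, hc₀, hc₀0⟩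
  refine hP.map_primitive_ne_zero c ⟨hc, hc0, ?_⟩ hGc
  rintro ⟨a, b, ha, ha0, hb, hb0, rfl⟩
  have hGa : G a = 0 := by
    refine hzero _ (hmem _ ha.mem_symmetricCone) ?_
    have h : G a + G b = 0 := by rw [← map_add]; exact hGc
    rw [neg_eq_of_add_eq_zero_right h]
    exact hmem _ hb.mem_symmetricCone
  exact (A.norm_lt_norm_add ha hb hc hb0).not_ge (hmin a hGa ha ha0)
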